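/- **Conventions.** A *signature* $\Theta$ is a set (of any size) of propositional letters; any set may serve as a letter, and letters are distinct from logical symbols. A *$\Theta$-model* $\mathcal M=\langle W,\prec,V\rangle$ consists of a non-empty set $W$, a (reflexive) partial order $\prec$ on $W$ and a map $V:\Theta\to 2^W$ whose values are upward closed under $\prec$; a *pointed* $\Theta$-model is a pair $(\mathcal M,w)$ with $w\in W$. For $\Sigma\subseteq\Theta$, $\mathcal M\upharpoonright\Sigma$ is the reduct of $\mathcal M$ to $\Sigma$. Submodels (worlds form a subset, order and valuation are the restricted ones) and isomorphisms of models are understood in the usual way, and the union of a countable chain of submodels is formed by taking unions of the sets of worlds, of the orders and of the valuations. $\mathsf{BIL}$ is bi-intuitionistic propositional logic: $BIL(\Theta)$ is the set of formulas built from letters of $\Theta$ with $\bot,\wedge,\vee,\to,\ll$, and satisfaction in pointed models is given by the usual clauses, in particular $\mathcal M,w\models\varphi\to\psi$ iff for all $v\succ w$, $\mathcal M,v\not\models\varphi$ or $\mathcal M,v\models\psi$, and $\mathcal M,w\models\varphi\ll\psi$ iff for some $v\prec w$, $\mathcal M,v\models\varphi$ and $\mathcal M,v\not\models\psi$. **Abstract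 logics.** An *abstract bi-intuitionistic logic* is a pair $\mathcal L=(L,\models_{\mathcal L})$, where $L$ assigns to every signature $\Theta$ a set $L(\Theta)$ of formulas and $\models_{\mathcal L}$ is a relation, defined exactly between pointed $\Theta$-models and elements of $L(\Theta)$ ($\Theta$ any signature), such that: 1. if $\Theta\subseteq\Theta'$, then $L(\Theta)\subseteq L(\Theta')$; 2. (Isomorphism) if $f:\mathcal M\cong\mathcal N$ is an isomorphism of $\Theta$-models and $\phi\in L(\Theta)$, then $\mathcal M,w\models_{\mathcal L}\phi$ iff $\mathcal N,f(w)\models_{\mathcal L}\phi$; 3. (Expansion) if $\Theta\subseteq\Theta'$, $\phi\in L(\Theta)$ and $\mathcal M$ is a $\Theta'$-model, then $\mathcal M,w\models_{\mathcal L}\phi$ iff $\mathcal M\upharpoonright\Theta,w\models_{\mathcal L}\phi$; 4. (Occurrence) if $\phi\in L(\Theta)$, there is a finite $\Theta_\phi\subseteq\Theta$ such that for every signature $\Theta'$, $\phi\in L(\Theta')$ (that is, satisfaction of $\phi$ in $\Theta'$-models is defined) iff $\Theta_\phi\subseteq\Theta'$; 5. (Closure) $\bot\in L(\Theta)$, and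 if $\phi,\psi\in L(\Theta)$, then $\phi\wedge\psi$, $\phi\vee\psi$, $\phi\to\psi$, $\phi\ll\psi\in L(\Theta)$, where these connectives have in $\mathcal L$ the same satisfaction clauses as in $\mathsf{BIL}$. Write $\mathcal L\sqsubseteq\mathcal L'$ ($\mathcal L'$ *extends* $\mathcal L$) if for every signature $\Theta$ and every $\phi\in L(\Theta)$ there is $\psi\in L'(\Theta)$ such that $\mathcal M,w\models_{\mathcal L}\phi$ iff $\mathcal M,w\models_{\mathcal L'}\psi$ for all pointed $\Theta$-models $(\mathcal M,w)$; and $\mathcal L\equiv\mathcal L'$ (*expressive equivalence*) if $\mathcal L\sqsubseteq\mathcal L'$ and $\mathcal L'\sqsubseteq\mathcal L$. For a pointed $\Theta$-model, let $Th^+_{\mathcal L}(\mathcal M,w)$ and $Th^-_{\mathcal L}(\mathcal M,w)$ be the sets of those $\phi\in L(\Theta)$ that are, respectively are not, satisfied at $(\mathcal M,w)$. **Properties.** * A *bi-asimulation* from a pointed $\Theta$-model $(\mathcal M_1,w_1)$ to $(\mathcal M_2,w_2)$, where $\mathcal M_i=\langle W_i,\prec_i,V_i\rangle$, is a relation $A\subseteq(W_1\times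 W_2)\cup(W_2\times W_1)$ (the two parts being kept apart) with $w_1\mathrel A w_2$ such that whenever $\{i,j\}=\{1,2\}$, $v\in W_i$, $s\in W_j$ and $v\mathrel A s$: (a) $v\in V_i(p)$ implies $s\in V_j(p)$, for all $p\in\Theta$; (b) if $s\prec_j t$, there is $u\in W_i$ with $v\prec_i u$, $t\mathrel A u$ and $u\mathrel A t$; (c) if $u\prec_i v$, there is $t\in W_j$ with $t\prec_j s$, $t\mathrel A u$ and $u\mathrel A t$. $\mathcal L$ is *preserved under bi-asimulations* if $Th^+_{\mathcal L}(\mathcal M_1,w_1)\subseteq Th^+_{\mathcal L}(\mathcal M_2,w_2)$ whenever there is a bi-asimulation from $(\mathcal M_1,w_1)$ to $(\mathcal M_2,w_2)$. * A pair $(\Gamma,\Delta)$ of subsets of $L(\Theta)$ is *satisfiable* if $\Gamma\subseteq Th^+_{\mathcal L}(\mathcal M,w)$ and $\Delta\subseteq Th^-_{\mathcal L}(\mathcal M,w)$ for some pointed $\Theta$-model $(\mathcal M,w)$. $\mathcal L$ is *$\star$-compact* if, for every $\Theta$, a pair $(\Gamma,\Delta)$ of subsets of $L(\Theta)$ is satisfiable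 whenever $(\Gamma',\Delta')$ is satisfiable for all finite $\Gamma'\subseteq\Gamma$, $\Delta'\subseteq\Delta$. * $\mathcal M\preccurlyeq_{\mathcal L}\mathcal N$ means that $\mathcal M$ is a submodel of $\mathcal N$ and that $Th^\pm_{\mathcal L}(\mathcal M,w)=Th^\pm_{\mathcal L}(\mathcal N,w)$ for all worlds $w$ of $\mathcal M$. $\mathcal L$ has the *Tarski Union Property* if for every chain $\mathcal M_0\preccurlyeq_{\mathcal L}\mathcal M_1\preccurlyeq_{\mathcal L}\cdots$ of $\Theta$-models, $\mathcal M_n\preccurlyeq_{\mathcal L}\bigcup_{k\in\omega}\mathcal M_k$ for all $n\in\omega$. **Theorem.** Let $\mathcal L$ be an abstract bi-intuitionistic logic. If $\mathsf{BIL}\sqsubseteq\mathcal L$ and $\mathcal L$ is preserved under bi-asimulations, is $\star$-compact and has the Tarski Union Property, then $\mathsf{BIL}\equiv\mathcal L$. -/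

import Mathlib

universe u v w

namespace BiInt

/-! ### Signatures, formulas and Kripke models -/

/-- The class of propositional letters: any set whatsoever may serve as a letter. Being a member
of the inductive type `Formula` below, a letter is never confused with a connective. -/
abbrev Letter : Type (u + 1) := ZFSet.{u}

/-- A signature is a set (as opposed to a proper class) of propositional letters. -/
abbrev Signature : Type (u + 1) := {Θ : Set Letter.{u} // Small.{u} Θ}

/-- Bi-intuitionistic propositional formulas over letters from `P`. -/
inductive Formula (P : Type w) : Type w
  | letter : P → Formula P
  | bot : Formula P
  | conj : Formula P → Formula P → Formula P
  | disj : Formula P → Formula P → Formula P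
  | impl : Formula P → Formula P → Formula P
  | coimpl : Formula P → Formula P → Formula P

/-- The set of letters that occur in a formula. -/
def Formula.letters {P : Type w} : Formula P → Set P
  | .letter p => {p}
  | .bot => ∅
  | .conj φ ψ => φ.letters ∪ ψ.letters
  | .disj φ ψ => φ.letters ∪ ψ.letters
  | .impl φ ψ => φ.letters ∪ ψ.letters
  | .coimpl φ ψ => φ.letters ∪ ψ.letters

/-- A Kripke `Θ`-model with set of worlds `W`: a non-empty partially ordered set with an
upward closed valuation of the letters of `Θ`. Models are taken with worlds in `Type u`,
the types that correspond to sets. -/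
structure Model (Θ : Signature.{u}) (W : Type u) where
  nonempty : Nonempty W
  rel : W → W → Prop
  rel_refl : ∀ a, rel a a
  rel_trans : ∀ a b c, rel a b → rel b c → rel a c
  rel_antisymm : ∀ a b, rel a b → rel b a → a = b
  val : Θ.1 → Set W
  val_mono : ∀ p a b, rel a b → a ∈ val p → b ∈ val p

namespace Model

/-- The reduct of a model to a smaller signature. -/
def reduct {Θ Θ' : Signature.{u}} {W : Type u} (M : Model Θ' W) (h : Θ.1 ⊆ Θ'.1) :
    Model Θ W where
  nonempty := M.nonempty
  rel := M.rel
  rel_refl := M.rel_refl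
  rel_trans := M.rel_trans
  rel_antisymm := M.rel_antisymm
  val p := M.val ⟨p.1, h p.2⟩
  val_mono p := M.val_mono ⟨p.1, h p.2⟩

/-- The bijection `g` is an isomorphism from `M` onto `N`. -/
structure IsIso {Θ : Signature.{u}} {W U : Type u} (M : Model Θ W) (N : Model Θ U)
    (g : W ≃ U) : Prop where
  rel_iff : ∀ a b, M.rel a b ↔ N.rel (g a) (g b)
  val_iff : ∀ p a, a ∈ M.val p ↔ g a ∈ N.val p

/-- `M` is a submodel of `N`, where the sets of worlds of the two models are subsets `S` and `T`
of a common ambient set. -/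
structure IsSubmodel {Θ : Signature.{u}} {A : Type u} {S T : Set A} (M : Model Θ S)
    (N : Model Θ T) : Prop where
  subset : S ⊆ T
  rel_iff : ∀ a b : S, M.rel a b ↔ N.rel (Set.inclusion subset a) (Set.inclusion subset b)
  val_iff : ∀ p, ∀ a : S, a ∈ M.val p ↔ Set.inclusion subset a ∈ N.val p

theorem IsSubmodel.refl {Θ : Signature.{u}} {A : Type u} {S : Set A} (M : Model Θ S) :
    M.IsSubmodel M :=
  ⟨subset_rfl, fun _ _ => Iff.rfl, fun _ _ => Iff.rfl⟩

theorem IsSubmodel.trans {Θ : Signature.{u}} {A : Type u} {S T R : Set A} {M : Model Θ S}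
    {N : Model Θ T} {K : Model Θ R} (h : M.IsSubmodel N) (h' : N.IsSubmodel K) :
    M.IsSubmodel K :=
  ⟨h.subset.trans h'.subset, fun a b => (h.rel_iff a b).trans (h'.rel_iff _ _),
    fun p a => (h.val_iff p a).trans (h'.val_iff p _)⟩

theorem IsSubmodel.of_le {Θ : Signature.{u}} {A : Type u} {S : ℕ → Set A}
    {M : ∀ n, Model Θ (S n)} (h : ∀ n, (M n).IsSubmodel (M (n + 1))) {m n : ℕ} (hmn : m ≤ n) :
    (M m).IsSubmodel (M n) := by
  induction n, hmn using Nat.le_induction with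
  | base => exact IsSubmodel.refl _
  | succ n _ ih => exact ih.trans (h n)

/-- The union of a countable chain of models: worlds, accessibility relation and valuation are
the unions of those of the members of the chain. -/
def iUnion {Θ : Signature.{u}} {A : Type u} (S : ℕ → Set A) (M : ∀ n, Model Θ (S n))
    (h : ∀ n, (M n).IsSubmodel (M (n + 1))) : Model Θ (⋃ n, S n : Set A) where
  nonempty := by
    obtain ⟨a⟩ := (M 0).nonempty
    exact ⟨⟨a.1, Set.mem_iUnion.2 ⟨0, a.2⟩⟩⟩
  rel a b := ∃ (n : ℕ) (ha : a.1 ∈ S n) (hb : b.1 ∈ S n), (M n).rel ⟨a.1, ha⟩ ⟨b.1, hb⟩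
  rel_refl a := by
    obtain ⟨n, hn⟩ := Set.mem_iUnion.1 a.2
    exact ⟨n, hn, hn, (M n).rel_refl _⟩
  rel_trans := by
    rintro a b c ⟨m, ha, hb, hab⟩ ⟨n, hb', hc, hbc⟩
    have h1 := IsSubmodel.of_le h (le_max_left m n)
    have h2 := IsSubmodel.of_le h (le_max_right m n)
    exact ⟨max m n, h1.subset ha, h2.subset hc,
      (M (max m n)).rel_trans _ _ _ ((h1.rel_iff _ _).1 hab) ((h2.rel_iff _ _).1 hbc)⟩
  rel_antisymm := by
    rintro a b ⟨m, ha, hb, hab⟩ ⟨n, hb', ha', hba⟩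
    have h1 := IsSubmodel.of_le h (le_max_left m n)
    have h2 := IsSubmodel.of_le h (le_max_right m n)
    have := (M (max m n)).rel_antisymm _ _ ((h1.rel_iff _ _).1 hab) ((h2.rel_iff _ _).1 hba)
    exact Subtype.ext (Subtype.mk.inj this)
  val p := {a | ∃ (n : ℕ) (ha : a.1 ∈ S n), (⟨a.1, ha⟩ : S n) ∈ (M n).val p}
  val_mono := by
    rintro p a b ⟨m, ha, hb, hab⟩ ⟨n, ha', hav⟩
    have h1 := IsSubmodel.of_le h (le_max_left m n)
    have h2 := IsSubmodel.of_le h (le_max_right m n)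
    exact ⟨max m n, h1.subset hb,
      (M (max m n)).val_mono p _ _ ((h1.rel_iff _ _).1 hab) ((h2.val_iff p _).1 hav)⟩

/-- Satisfaction of bi-intuitionistic formulas at a world of a Kripke model. -/
def Forces {Θ : Signature.{u}} {W : Type u} (M : Model Θ W) : W → Formula Letter.{u} → Prop
  | a, .letter p => ∃ h : p ∈ Θ.1, a ∈ M.val ⟨p, h⟩
  | _, .bot => False
  | a, .conj φ ψ => M.Forces a φ ∧ M.Forces a ψ
  | a, .disj φ ψ => M.Forces a φ ∨ M.Forces a ψ
  | a, .impl φ ψ => ∀ b, M.rel a b → ¬ M.Forces b φ ∨ M.Forces b ψ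
  | a, .coimpl φ ψ => ∃ b, M.rel b a ∧ M.Forces b φ ∧ ¬ M.Forces b ψ

end Model

/-- A bi-asimulation from `(M₁, w₁)` to `(M₂, w₂)`. The relation `A ⊆ (W₁ × W₂) ∪ (W₂ × W₁)` is
given by its two parts `A₁₂ ⊆ W₁ × W₂` and `A₂₁ ⊆ W₂ × W₁`. -/
structure IsBiasimulation {Θ : Signature.{u}} {W₁ W₂ : Type u} (M₁ : Model Θ W₁) (w₁ : W₁)
    (M₂ : Model Θ W₂) (w₂ : W₂) (A₁₂ : W₁ → W₂ → Prop) (A₂₁ : W₂ → W₁ → Prop) : Prop where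
  elem : A₁₂ w₁ w₂
  atom₁₂ : ∀ p a s, A₁₂ a s → a ∈ M₁.val p → s ∈ M₂.val p
  atom₂₁ : ∀ p a s, A₂₁ a s → a ∈ M₂.val p → s ∈ M₁.val p
  back₁₂ : ∀ a s t, A₁₂ a s → M₂.rel s t → ∃ b, M₁.rel a b ∧ A₂₁ t b ∧ A₁₂ b t
  back₂₁ : ∀ a s t, A₂₁ a s → M₁.rel s t → ∃ b, M₂.rel a b ∧ A₁₂ t b ∧ A₂₁ b t
  forth₁₂ : ∀ a b s, A₁₂ a s → M₁.rel b a → ∃ t, M₂.rel t s ∧ A₂₁ t b ∧ A₁₂ b t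
  forth₂₁ : ∀ a b s, A₂₁ a s → M₂.rel b a → ∃ t, M₁.rel t s ∧ A₁₂ t b ∧ A₂₁ b t

/-! ### Abstract bi-intuitionistic logics -/

/-- An abstract bi-intuitionistic logic. `Form` is the class of all formulas of the logic, `lang Θ`
is the set of its `Θ`-formulas and `Sat` its satisfaction relation. Whether a formula `φ` is
satisfied in a pointed `Θ`-model is defined exactly if `φ ∈ lang Θ`; the values of `Sat` for other
arguments are junk, about which nothing is assumed and which are never used. -/
structure AbstractLogic where
  Form : Type v
  lang : Signature.{u} → Set Form
  Sat : ∀ {Θ : Signature.{u}} {W : Type u}, Model Θ W → W → Form → Prop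
  /-- The `Θ`-formulas form a set rather than a proper class. -/
  small_lang : ∀ Θ, Small.{u} (lang Θ)
  lang_mono : ∀ Θ Θ' : Signature.{u}, Θ.1 ⊆ Θ'.1 → lang Θ ⊆ lang Θ'
  isomorphism : ∀ {Θ : Signature.{u}} {W U : Type u} (M : Model Θ W) (N : Model Θ U) (g : W ≃ U),
    M.IsIso N g → ∀ (a : W), ∀ φ ∈ lang Θ, (Sat M a φ ↔ Sat N (g a) φ)
  expansion : ∀ {Θ Θ' : Signature.{u}} (h : Θ.1 ⊆ Θ'.1) {W : Type u} (M : Model Θ' W) (a : W),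
    ∀ φ ∈ lang Θ, (Sat M a φ ↔ Sat (M.reduct h) a φ)
  occurrence : ∀ Θ : Signature.{u}, ∀ φ ∈ lang Θ, ∃ Θφ : Set Letter.{u}, Θφ.Finite ∧ Θφ ⊆ Θ.1 ∧
    ∀ Θ' : Signature.{u}, φ ∈ lang Θ' ↔ Θφ ⊆ Θ'.1
  bot : Form
  conj : Form → Form → Form
  disj : Form → Form → Form
  impl : Form → Form → Form
  coimpl : Form → Form → Form
  bot_mem : ∀ Θ, bot ∈ lang Θ
  conj_mem : ∀ Θ, ∀ φ ∈ lang Θ, ∀ ψ ∈ lang Θ, conj φ ψ ∈ lang Θ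
  disj_mem : ∀ Θ, ∀ φ ∈ lang Θ, ∀ ψ ∈ lang Θ, disj φ ψ ∈ lang Θ
  impl_mem : ∀ Θ, ∀ φ ∈ lang Θ, ∀ ψ ∈ lang Θ, impl φ ψ ∈ lang Θ
  coimpl_mem : ∀ Θ, ∀ φ ∈ lang Θ, ∀ ψ ∈ lang Θ, coimpl φ ψ ∈ lang Θ
  sat_bot : ∀ {Θ : Signature.{u}} {W : Type u} (M : Model Θ W) (a : W), ¬ Sat M a bot
  sat_conj : ∀ {Θ : Signature.{u}} {W : Type u} (M : Model Θ W) (a : W),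
    ∀ φ ∈ lang Θ, ∀ ψ ∈ lang Θ, (Sat M a (conj φ ψ) ↔ Sat M a φ ∧ Sat M a ψ)
  sat_disj : ∀ {Θ : Signature.{u}} {W : Type u} (M : Model Θ W) (a : W),
    ∀ φ ∈ lang Θ, ∀ ψ ∈ lang Θ, (Sat M a (disj φ ψ) ↔ Sat M a φ ∨ Sat M a ψ)
  sat_impl : ∀ {Θ : Signature.{u}} {W : Type u} (M : Model Θ W) (a : W),
    ∀ φ ∈ lang Θ, ∀ ψ ∈ lang Θ,
      (Sat M a (impl φ ψ) ↔ ∀ b, M.rel a b → ¬ Sat M b φ ∨ Sat M b ψ)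
  sat_coimpl : ∀ {Θ : Signature.{u}} {W : Type u} (M : Model Θ W) (a : W),
    ∀ φ ∈ lang Θ, ∀ ψ ∈ lang Θ,
      (Sat M a (coimpl φ ψ) ↔ ∃ b, M.rel b a ∧ Sat M b φ ∧ ¬ Sat M b ψ)

namespace AbstractLogic

/-- `L'` extends `L`: every `Θ`-formula of `L` has an equivalent among the `Θ`-formulas of `L'`. -/
def ExtendedBy (L : AbstractLogic.{u, v}) (L' : AbstractLogic.{u, w}) : Prop :=
  ∀ Θ : Signature.{u}, ∀ φ ∈ L.lang Θ, ∃ ψ ∈ L'.lang Θ,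
    ∀ (W : Type u) (M : Model Θ W) (a : W), L.Sat M a φ ↔ L'.Sat M a ψ

/-- Expressive equivalence of abstract bi-intuitionistic logics. -/
def ExprEquiv (L : AbstractLogic.{u, v}) (L' : AbstractLogic.{u, w}) : Prop :=
  L.ExtendedBy L' ∧ L'.ExtendedBy L

/-- The positive part of the theory of a pointed model. -/
def thPos (L : AbstractLogic.{u, v}) {Θ : Signature.{u}} {W : Type u} (M : Model Θ W) (a : W) :
    Set L.Form :=
  {φ | φ ∈ L.lang Θ ∧ L.Sat M a φ}

/-- The negative part of the theory of a pointed model. -/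
def thNeg (L : AbstractLogic.{u, v}) {Θ : Signature.{u}} {W : Type u} (M : Model Θ W) (a : W) :
    Set L.Form :=
  {φ | φ ∈ L.lang Θ ∧ ¬ L.Sat M a φ}

/-- The theory `(Γ, Δ)` is satisfied at some pointed `Θ`-model. -/
def Satisfiable (L : AbstractLogic.{u, v}) (Θ : Signature.{u}) (Γ Δ : Set L.Form) : Prop :=
  ∃ (W : Type u) (M : Model Θ W) (a : W), Γ ⊆ L.thPos M a ∧ Δ ⊆ L.thNeg M a

/-- `M` is an `L`-elementary submodel of `N`. -/
def IsElemSubmodel (L : AbstractLogic.{u, v}) {Θ : Signature.{u}} {A : Type u} {S T : Set A}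
    (M : Model Θ S) (N : Model Θ T) : Prop :=
  ∃ h : M.IsSubmodel N, ∀ a : S,
    L.thPos M a = L.thPos N (Set.inclusion h.subset a) ∧
    L.thNeg M a = L.thNeg N (Set.inclusion h.subset a)

/-- `L` is preserved under bi-asimulations. -/
def PreservedUnderBiasimulations (L : AbstractLogic.{u, v}) : Prop :=
  ∀ (Θ : Signature.{u}) (W₁ W₂ : Type u) (M₁ : Model Θ W₁) (w₁ : W₁) (M₂ : Model Θ W₂) (w₂ : W₂)
    (A₁₂ : W₁ → W₂ → Prop) (A₂₁ : W₂ → W₁ → Prop),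
    IsBiasimulation M₁ w₁ M₂ w₂ A₁₂ A₂₁ → L.thPos M₁ w₁ ⊆ L.thPos M₂ w₂

/-- `L` is `⋆`-compact. -/
def StarCompact (L : AbstractLogic.{u, v}) : Prop :=
  ∀ (Θ : Signature.{u}) (Γ Δ : Set L.Form), Γ ⊆ L.lang Θ → Δ ⊆ L.lang Θ →
    (∀ Γ' Δ' : Set L.Form, Γ' ⊆ Γ → Γ'.Finite → Δ' ⊆ Δ → Δ'.Finite → L.Satisfiable Θ Γ' Δ') →
    L.Satisfiable Θ Γ Δ

/-- The Tarski Union Property. -/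
def TarskiUnionProperty (L : AbstractLogic.{u, v}) : Prop :=
  ∀ (Θ : Signature.{u}) (A : Type u) (S : ℕ → Set A) (M : ∀ n, Model Θ (S n))
    (h : ∀ n, L.IsElemSubmodel (M n) (M (n + 1))),
    ∀ n, L.IsElemSubmodel (M n) (Model.iUnion S M fun k => (h k).1)

end AbstractLogic

/-! ### Bi-intuitionistic propositional logic as an abstract logic -/

/-- Renaming of letters. -/
def Formula.map {P : Type v} {Q : Type w} (f : P → Q) : Formula P → Formula Q
  | .letter p => .letter (f p)
  | .bot => .bot
  | .conj φ ψ => .conj (φ.map f) (ψ.map f)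
  | .disj φ ψ => .disj (φ.map f) (ψ.map f)
  | .impl φ ψ => .impl (φ.map f) (ψ.map f)
  | .coimpl φ ψ => .coimpl (φ.map f) (ψ.map f)

theorem Formula.exists_map {P : Type v} {Q : Type w} (f : P → Q) (φ : Formula Q)
    (h : φ.letters ⊆ Set.range f) : ∃ χ : Formula P, χ.map f = φ := by
  induction φ with
  | letter q =>
    obtain ⟨p, rfl⟩ := h rfl
    exact ⟨.letter p, rfl⟩
  | bot => exact ⟨.bot, rfl⟩
  | conj φ ψ ih ih' =>
    obtain ⟨χ, rfl⟩ := ih (Set.subset_union_left.trans h)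
    obtain ⟨χ', rfl⟩ := ih' (Set.subset_union_right.trans h)
    exact ⟨.conj χ χ', rfl⟩
  | disj φ ψ ih ih' =>
    obtain ⟨χ, rfl⟩ := ih (Set.subset_union_left.trans h)
    obtain ⟨χ', rfl⟩ := ih' (Set.subset_union_right.trans h)
    exact ⟨.disj χ χ', rfl⟩
  | impl φ ψ ih ih' =>
    obtain ⟨χ, rfl⟩ := ih (Set.subset_union_left.trans h)
    obtain ⟨χ', rfl⟩ := ih' (Set.subset_union_right.trans h)
    exact ⟨.impl χ χ', rfl⟩
  | coimpl φ ψ ih ih' =>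
    obtain ⟨χ, rfl⟩ := ih (Set.subset_union_left.trans h)
    obtain ⟨χ', rfl⟩ := ih' (Set.subset_union_right.trans h)
    exact ⟨.coimpl χ χ', rfl⟩

theorem Formula.small_lang (Θ : Signature.{u}) :
    Small.{u} {φ : Formula Letter.{u} | φ.letters ⊆ Θ.1} := by
  have := Θ.2
  let f : Shrink.{u} Θ.1 → Letter.{u} := fun p => ((equivShrink Θ.1).symm p).1
  have hsub : {φ : Formula Letter.{u} | φ.letters ⊆ Θ.1} ⊆ Set.range (Formula.map f) := by
    intro φ hφ
    refine Formula.exists_map f φ fun p hp => ⟨equivShrink Θ.1 ⟨p, hφ hp⟩, ?_⟩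
    simp [f]
  exact small_subset hsub

theorem Formula.letters_finite {P : Type w} (φ : Formula P) : φ.letters.Finite := by
  induction φ with
  | letter p => exact Set.finite_singleton p
  | bot => exact Set.finite_empty
  | conj _ _ ih ih' => exact ih.union ih'
  | disj _ _ ih ih' => exact ih.union ih'
  | impl _ _ ih ih' => exact ih.union ih'
  | coimpl _ _ ih ih' => exact ih.union ih'

theorem Model.IsIso.forces_iff {Θ : Signature.{u}} {W U : Type u} {M : Model Θ W} {N : Model Θ U}
    {g : W ≃ U} (h : M.IsIso N g) (φ : Formula Letter.{u}) (a : W) :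
    M.Forces a φ ↔ N.Forces (g a) φ := by
  induction φ generalizing a with
  | letter p => simp only [Model.Forces, h.val_iff]
  | bot => simp only [Model.Forces]
  | conj _ _ ih ih' => simp only [Model.Forces, ih, ih']
  | disj _ _ ih ih' => simp only [Model.Forces, ih, ih']
  | impl _ _ ih ih' => simp only [Model.Forces, ih, ih', h.rel_iff, g.surjective.forall]
  | coimpl _ _ ih ih' => simp only [Model.Forces, ih, ih', h.rel_iff, g.surjective.exists]

theorem Model.forces_reduct_iff {Θ Θ' : Signature.{u}} (h : Θ.1 ⊆ Θ'.1) {W : Type u}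
    (M : Model Θ' W) (φ : Formula Letter.{u}) (hφ : φ.letters ⊆ Θ.1) (a : W) :
    M.Forces a φ ↔ (M.reduct h).Forces a φ := by
  induction φ generalizing a with
  | letter p =>
    have hp : p ∈ Θ.1 := hφ rfl
    simp only [Model.Forces, Model.reduct, hp, h hp, exists_true_left]
  | bot => simp only [Model.Forces]
  | conj _ _ ih ih' =>
    simp only [Model.Forces, ih (Set.subset_union_left.trans hφ),
      ih' (Set.subset_union_right.trans hφ)]
  | disj _ _ ih ih' =>
    simp only [Model.Forces, ih (Set.subset_union_left.trans hφ),
      ih' (Set.subset_union_right.trans hφ)]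
  | impl _ _ ih ih' =>
    simp only [Model.Forces, ih (Set.subset_union_left.trans hφ),
      ih' (Set.subset_union_right.trans hφ)]
    rfl
  | coimpl _ _ ih ih' =>
    simp only [Model.Forces, ih (Set.subset_union_left.trans hφ),
      ih' (Set.subset_union_right.trans hφ)]
    rfl

/-- Bi-intuitionistic propositional logic `BIL`. -/
def BIL : AbstractLogic.{u, u + 1} where
  Form := Formula Letter.{u}
  lang Θ := {φ | φ.letters ⊆ Θ.1}
  Sat M a φ := M.Forces a φ
  small_lang := Formula.small_lang
  lang_mono _ _ h _ hφ := hφ.trans h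
  isomorphism _ _ _ h a φ _ := h.forces_iff φ a
  expansion h _ M a φ hφ := M.forces_reduct_iff h φ hφ a
  occurrence _ φ hφ := ⟨φ.letters, φ.letters_finite, hφ, fun _ => Iff.rfl⟩
  bot := .bot
  conj := .conj
  disj := .disj
  impl := .impl
  coimpl := .coimpl
  bot_mem _ := Set.empty_subset _
  conj_mem _ _ h _ h' := Set.union_subset h h'
  disj_mem _ _ h _ h' := Set.union_subset h h'
  impl_mem _ _ h _ h' := Set.union_subset h h'
  coimpl_mem _ _ h _ h' := Set.union_subset h h'
  sat_bot _ _ h := h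
  sat_conj _ _ _ _ _ _ := Iff.rfl
  sat_disj _ _ _ _ _ _ := Iff.rfl
  sat_impl _ _ _ _ _ _ := Iff.rfl
  sat_coimpl _ _ _ _ _ _ := Iff.rfl

end BiInt

/-! Compactness reduces the theorem to one claim: the truth of each formula of `L` passes along
inclusions of `BIL`-theories (`exists_BIL_equiv`). Between models saturated for `BIL`, such an
inclusion is itself a bi-asimulation (`isBiasimulation_of_isSaturated`), so it is enough that every
pointed model is `L`-equivalent to a saturated one (`exists_saturated`). The latter is the union of
an ω-chain, elementary by the Tarski Union Property, in which each stage realizes the limit types of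
the ultrafilters on the stage before (`exists_ultrafilter_extension`).

The difficulty lies in a single extension step. Only upward closed sets can be named by letters, so
worlds have no names, and a model supplied by compactness may contain many worlds that fit a given
old world. These candidates are linked by zigzag moves, and an embedding has to choose among them
monotonically. If the old model is a tree of zigzag paths, the choice can be made recursively along
the paths; `Model.Projective` records this property. Unravelling a model into such a tree does not
change `L`-theories, by preservation under bi-asimulations, so every stage can be taken to be
projective. -/

namespace BiInt

variable {Θ : Signature.{u}} {W : Type u}

/-! ### Persistence and definable operators -/

namespace AbstractLogic

variable (L : AbstractLogic.{u, v})

/-- Every formula of a logic preserved under bi-asimulations is persistent. -/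
theorem PreservedUnderBiasimulations.sat_mono {L : AbstractLogic.{u, v}}
    (hpres : L.PreservedUnderBiasimulations) (M : Model Θ W) {a b : W} (hab : M.rel a b)
    {φ : L.Form} (hφ : φ ∈ L.lang Θ) (h : L.Sat M a φ) : L.Sat M b φ := by
  -- The identity in both directions, plus the one pair `(a, b)`; by transitivity every move from
  -- that pair is answered on the diagonal.
  refine (hpres Θ W W M a M b (fun x y => x = y ∨ M.rel x y ∧ x = a ∧ y = b) (fun x y => x = y)
    ⟨Or.inr ⟨hab, rfl, rfl⟩, ?_, ?_, ?_, ?_, ?_, ?_⟩ ⟨hφ, h⟩).2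
  · rintro p x y (rfl | ⟨hxy, -, -⟩) hx
    exacts [hx, M.val_mono p _ _ hxy hx]
  · rintro p x y rfl hx
    exact hx
  · rintro x s t (rfl | ⟨hxy, -, -⟩) hst
    exacts [⟨t, hst, rfl, Or.inl rfl⟩, ⟨t, M.rel_trans _ _ _ hxy hst, rfl, Or.inl rfl⟩]
  · rintro x s t rfl hst
    exact ⟨t, hst, Or.inl rfl, rfl⟩
  · rintro x y s (rfl | ⟨hxy, -, -⟩) hst
    exacts [⟨y, hst, rfl, Or.inl rfl⟩, ⟨y, M.rel_trans _ _ _ hst hxy, rfl, Or.inl rfl⟩]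
  · rintro x y s rfl hst
    exact ⟨y, hst, Or.inl rfl, rfl⟩

/-- A formula that is true everywhere. -/
def top : L.Form := L.impl L.bot L.bot

/-- `box φ` says that `φ` holds at all worlds below a world above the present one. -/
def box (φ : L.Form) : L.Form := L.impl (L.coimpl L.top φ) L.bot

theorem top_mem (Θ : Signature.{u}) : L.top ∈ L.lang Θ :=
  L.impl_mem Θ _ (L.bot_mem Θ) _ (L.bot_mem Θ)

theorem sat_top (M : Model Θ W) (a : W) : L.Sat M a L.top :=
  (L.sat_impl M a _ (L.bot_mem Θ) _ (L.bot_mem Θ)).2 fun b _ => Or.inl (L.sat_bot M b)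

theorem box_mem {φ : L.Form} (hφ : φ ∈ L.lang Θ) : L.box φ ∈ L.lang Θ :=
  L.impl_mem Θ _ (L.coimpl_mem Θ _ (L.top_mem Θ) _ hφ) _ (L.bot_mem Θ)

theorem sat_box (M : Model Θ W) (a : W) {φ : L.Form} (hφ : φ ∈ L.lang Θ) :
    L.Sat M a (L.box φ) ↔ ∀ b c, M.rel a b → M.rel c b → L.Sat M c φ := by
  rw [box, L.sat_impl M a _ (L.coimpl_mem Θ _ (L.top_mem Θ) _ hφ) _ (L.bot_mem Θ)]
  simp only [L.sat_bot, or_false, L.sat_coimpl M _ _ (L.top_mem Θ) _ hφ, L.sat_top, true_and,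
    not_exists, not_and, not_not]
  exact ⟨fun h b c hab hcb => h b hab c hcb, fun h b hab c hcb => h b c hab hcb⟩

/-- The letter `p` has a counterpart in every extension of `BIL`. -/
theorem ExtendedBy.exists_letter {L : AbstractLogic.{u, v}} (hext : BIL.{u}.ExtendedBy L)
    (p : Θ.1) : ∃ ψ ∈ L.lang Θ, ∀ (W : Type u) (M : Model Θ W) (a : W),
      L.Sat M a ψ ↔ a ∈ M.val p := by
  obtain ⟨ψ, hψ, h'⟩ := hext Θ (.letter p.1) (Set.singleton_subset_iff.2 p.2)
  refine ⟨ψ, hψ, fun W M a => (h' W M a).symm.trans ⟨fun ⟨_, ha⟩ => ha, fun ha => ⟨p.2, ha⟩⟩⟩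

end AbstractLogic

/-! ### Fresh letters and expansions -/

/-- Otherwise there would be a set of all sets, which would be a member of itself. -/
theorem not_small_letter : ¬ Small.{u} Letter.{u} := fun _ =>
  ZFSet.mem_irrefl (ZFSet.range (id : ZFSet.{u} → ZFSet.{u})) (ZFSet.mem_range.2 ⟨_, rfl⟩)

/-- There are enough letters outside any given signature. -/
theorem exists_fresh_letters (Θ : Signature.{u}) (J : Type u) :
    ∃ g : J → Letter.{u}, Function.Injective g ∧ ∀ j, g j ∉ Θ.1 := by
  have hns : ¬ Small.{u} (Θ.1ᶜ : Set Letter.{u}) := by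
    intro h
    have := Θ.2
    have h2 : Small.{u} (Θ.1 ∪ Θ.1ᶜ : Set Letter.{u}) := inferInstance
    rw [Set.union_compl_self] at h2
    exact not_small_letter (small_of_injective (Equiv.Set.univ Letter.{u}).symm.injective)
  -- A set of letters that is not small has cardinality at least `univ`, which exceeds that of any
  -- type in `Type u`.
  rw [Cardinal.small_iff_lift_mk_lt_univ, not_lt] at hns
  rw [Cardinal.lift_id] at hns
  have hlt := (Cardinal.lift_lt_univ (Cardinal.mk J)).le.trans hns
  obtain ⟨g⟩ := Cardinal.lift_mk_le'.1 (hlt.trans_eq (Cardinal.lift_id'.{u, u + 1} _).symm)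
  exact ⟨fun j => (g j).1, Subtype.val_injective.comp g.injective, fun j => (g j).2⟩

/-- Models can be expanded by arbitrary upward closed sets, which get names `n j`. -/
theorem exists_expansion {L : AbstractLogic.{u, v}} (hext : BIL.{u}.ExtendedBy L)
    (Θ : Signature.{u}) (J : Type u) :
    ∃ (Θ' : Signature.{u}) (_ : Θ.1 ⊆ Θ'.1) (n : J → L.Form), (∀ j, n j ∈ L.lang Θ') ∧
      ∀ {W : Type u} (M : Model Θ W) (X : J → Set W),
        (∀ j a b, M.rel a b → a ∈ X j → b ∈ X j) → ∃ M' : Model Θ' W, M'.rel = M.rel ∧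
          (∀ φ ∈ L.lang Θ, ∀ a, L.Sat M' a φ ↔ L.Sat M a φ) ∧
          ∀ j a, L.Sat M' a (n j) ↔ a ∈ X j := by
  obtain ⟨g, hg, hgΘ⟩ := exists_fresh_letters Θ J
  have := Θ.2
  let Θ' : Signature.{u} := ⟨Θ.1 ∪ Set.range g, inferInstance⟩
  have hsub : Θ.1 ⊆ Θ'.1 := Set.subset_union_left
  choose n hn hn' using fun j => hext.exists_letter (Θ := Θ') ⟨g j, Or.inr ⟨j, rfl⟩⟩
  refine ⟨Θ', hsub, n, hn, fun {W} M X hX => ?_⟩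
  let M' : Model Θ' W :=
    { nonempty := M.nonempty
      rel := M.rel
      rel_refl := M.rel_refl
      rel_trans := M.rel_trans
      rel_antisymm := M.rel_antisymm
      val := fun p => {a | (∃ h : p.1 ∈ Θ.1, a ∈ M.val ⟨p.1, h⟩) ∨ ∃ j, g j = p.1 ∧ a ∈ X j}
      val_mono := by
        rintro p a b hab (⟨h, ha⟩ | ⟨j, hj, ha⟩)
        exacts [Or.inl ⟨h, M.val_mono _ _ _ hab ha⟩, Or.inr ⟨j, hj, hX _ _ _ hab ha⟩] }
  refine ⟨M', rfl, fun φ hφ a => ?_, fun j a => ?_⟩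
  · rw [L.expansion hsub M' a φ hφ]
    refine L.isomorphism (M'.reduct hsub) M (Equiv.refl W) ⟨fun _ _ => Iff.rfl, ?_⟩ a φ hφ
    rintro ⟨p, hp⟩ b
    constructor
    · rintro (⟨h, hb⟩ | ⟨j, hj, hb⟩)
      exacts [hb, (hgΘ j (hj ▸ hp)).elim]
    · exact fun hb => Or.inl ⟨hp, hb⟩
  · rw [hn']
    constructor
    · rintro (⟨h, -⟩ | ⟨i, hi, ha⟩)
      exacts [(hgΘ j h).elim, hg hi ▸ ha]
    · exact fun ha => Or.inr ⟨j, rfl, ha⟩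

/-! ### Unravelling -/

namespace Model

/-- Zigzag paths in `M` from `r`. -/
inductive Path (M : Model Θ W) (r : W) : W → Type u
  | nil : Path M r r
  | up {a b : W} : Path M r a → M.rel a b → Path M r b
  | down {a b : W} : Path M r a → M.rel b a → Path M r b

/-- The number of ascending steps minus the number of descending ones. -/
def Path.height {M : Model Θ W} {r : W} : {a : W} → Path M r a → ℤ
  | _, .nil => 0
  | _, .up p _ => p.height + 1
  | _, .down p _ => p.height - 1

/-- The generating relation of the order on zigzag paths. -/
inductive Path.Edge (M : Model Θ W) (r : W) : (Σ a, Path M r a) → (Σ a, Path M r a) → Prop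
  | up {a b : W} (p : Path M r a) (h : M.rel a b) : Edge M r ⟨a, p⟩ ⟨b, p.up h⟩
  | down {a b : W} (p : Path M r a) (h : M.rel b a) : Edge M r ⟨b, p.down h⟩ ⟨a, p⟩

/-- The strictly increasing height makes the order generated by the edges antisymmetric. -/
theorem Path.Edge.height_lt {M : Model Θ W} {r : W} {s t : Σ a, Path M r a}
    (h : Path.Edge M r s t) : s.2.height < t.2.height := by
  cases h <;> simp [Path.height]

theorem Path.Edge.rel {M : Model Θ W} {r : W} {s t : Σ a, Path M r a}
    (h : Relation.ReflTransGen (Path.Edge M r) s t) : M.rel s.1 t.1 := by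
  induction h with
  | refl => exact M.rel_refl _
  | tail _ h ih =>
    refine M.rel_trans _ _ _ ih ?_
    cases h <;> assumption

/-- The tree of zigzag paths from `r`. -/
def unravel (M : Model Θ W) (r : W) : Model Θ (Σ a, Path M r a) where
  nonempty := ⟨⟨r, .nil⟩⟩
  rel := Relation.ReflTransGen (Path.Edge M r)
  rel_refl _ := .refl
  rel_trans _ _ _ h h' := h.trans h'
  rel_antisymm s t h h' := by
    have key : ∀ {s t : Σ a, Path M r a}, Relation.ReflTransGen (Path.Edge M r) s t →
        s = t ∨ s.2.height < t.2.height := by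
      intro s t h
      induction h with
      | refl => exact Or.inl rfl
      | tail _ h ih =>
        right
        rcases ih with rfl | ih
        exacts [h.height_lt, ih.trans h.height_lt]
    rcases key h with h | h
    · exact h
    · rcases key h' with h' | h'
      exacts [h'.symm, (lt_asymm h h').elim]
  val p := {s | s.1 ∈ M.val p}
  val_mono p _ _ h hs := M.val_mono p _ _ (Path.Edge.rel h) hs

/-- The graph of the endpoint map and its converse form a bi-asimulation, whichever side one starts
from: a step of `M` from the endpoint lifts to a one-step prolongation of the path. -/
theorem sat_unravel_iff {L : AbstractLogic.{u, v}} (hpres : L.PreservedUnderBiasimulations)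
    (M : Model Θ W) (r : W) (s : Σ a, Path M r a) {φ : L.Form} (hφ : φ ∈ L.lang Θ) :
    L.Sat (M.unravel r) s φ ↔ L.Sat M s.1 φ := by
  have back : ∀ (s : Σ a, Path M r a) b, M.rel s.1 b → ∃ t, (M.unravel r).rel s t ∧ t.1 = b :=
    fun s b h => ⟨⟨b, s.2.up h⟩, .single (.up s.2 h), rfl⟩
  have forth : ∀ (s : Σ a, Path M r a) b, M.rel b s.1 → ∃ t, (M.unravel r).rel t s ∧ t.1 = b :=
    fun s b h => ⟨⟨b, s.2.down h⟩, .single (.down s.2 h), rfl⟩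
  constructor
  · intro h
    refine (hpres Θ _ _ (M.unravel r) s M s.1 (fun s a => s.1 = a) (fun a s => s.1 = a)
      ⟨rfl, ?_, ?_, ?_, ?_, ?_, ?_⟩ ⟨hφ, h⟩).2
    · rintro p a _ rfl h
      exact h
    · rintro p _ a rfl h
      exact h
    · rintro a _ t rfl h
      obtain ⟨b, h, hb⟩ := back a t h
      exact ⟨b, h, hb, hb⟩
    · rintro _ a t rfl h
      exact ⟨t.1, Path.Edge.rel h, rfl, rfl⟩
    · rintro a b _ rfl h
      exact ⟨b.1, Path.Edge.rel h, rfl, rfl⟩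
    · rintro _ b a rfl h
      obtain ⟨b, h, hb⟩ := forth a b h
      exact ⟨b, h, hb, hb⟩
  · intro h
    refine (hpres Θ _ _ M s.1 (M.unravel r) s (fun a s => s.1 = a) (fun s a => s.1 = a)
      ⟨rfl, ?_, ?_, ?_, ?_, ?_, ?_⟩ ⟨hφ, h⟩).2
    · rintro p _ a rfl h
      exact h
    · rintro p a _ rfl h
      exact h
    · rintro _ a t rfl h
      exact ⟨t.1, Path.Edge.rel h, rfl, rfl⟩
    · rintro a _ t rfl h
      obtain ⟨b, h, hb⟩ := back a t h
      exact ⟨b, h, hb, hb⟩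
    · rintro _ b a rfl h
      obtain ⟨b, h, hb⟩ := forth a b h
      exact ⟨b, h, hb, hb⟩
    · rintro a b _ rfl h
      exact ⟨b.1, Path.Edge.rel h, rfl, rfl⟩

/-- `M` is projective at `r` if every zigzag relation from `M` to a preordered set that relates
`r` to some element contains a monotone map. -/
def Projective (M : Model Θ W) (r : W) : Prop :=
  ∀ (X : Type u) (le : X → X → Prop), (∀ x, le x x) → (∀ x y z, le x y → le y z → le x z) →
    ∀ R : W → X → Prop, (∃ x, R r x) →
      (∀ a b x, M.rel a b → R a x → ∃ y, le x y ∧ R b y) →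
      (∀ a b x, M.rel b a → R a x → ∃ y, le y x ∧ R b y) →
      ∃ e : W → X, (∀ a, R a (e a)) ∧ ∀ a b, M.rel a b → le (e a) (e b)

/-- Each edge joins a path to a one-step prolongation of it, so values chosen by recursion on paths
respect every edge, hence the order. -/
theorem projective_unravel (M : Model Θ W) (r : W) :
    (M.unravel r).Projective ⟨r, .nil⟩ := by
  intro X le hrefl htrans R ⟨x₀, hx₀⟩ hup hdown
  choose f hf hf' using hup
  choose g hg hg' using hdown
  let e : ∀ (a : W) (p : Path M r a), {x // R ⟨a, p⟩ x} := fun a p =>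
    Path.rec (motive := fun a p => {x // R ⟨a, p⟩ x}) ⟨x₀, hx₀⟩
      (fun {a b} p h x => ⟨f _ _ x.1 (.single (.up p h)) x.2, hf' _ _ _ _ _⟩)
      (fun {a b} p h x => ⟨g _ _ x.1 (.single (.down p h)) x.2, hg' _ _ _ _ _⟩) p
  refine ⟨fun s => (e s.1 s.2).1, fun s => (e s.1 s.2).2, fun s t h => ?_⟩
  induction h with
  | refl => exact hrefl _
  | tail _ h ih =>
    refine htrans _ _ _ ih ?_
    cases h with
    | up p h => exact hf _ _ _ _ _
    | down p h => exact hg _ _ _ _ _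

end Model

/-! ### Realizing ultrafilter limits by compactness -/

/-- Every projective model has a projective elementary extension that realizes the limit type of
every ultrafilter that contains the worlds above, or the worlds below, a given world. -/
theorem exists_ultrafilter_extension {L : AbstractLogic.{u, v}} (hext : BIL.{u}.ExtendedBy L)
    (hpres : L.PreservedUnderBiasimulations) (hcomp : L.StarCompact) (M : Model Θ W) (r : W)
    (hM : M.Projective r) :
    ∃ (W' : Type u) (M' : Model Θ W') (r' : W') (e : W → W'), M'.Projective r' ∧
      (∀ a b, M.rel a b ↔ M'.rel (e a) (e b)) ∧
      (∀ φ ∈ L.lang Θ, ∀ a, L.Sat M a φ ↔ L.Sat M' (e a) φ) ∧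
      (∀ a, ∀ U : Ultrafilter W, (∀ᶠ b in U, M.rel a b) →
        ∃ z, M'.rel (e a) z ∧ ∀ φ ∈ L.lang Θ, (L.Sat M' z φ ↔ ∀ᶠ b in U, L.Sat M b φ)) ∧
      (∀ a, ∀ U : Ultrafilter W, (∀ᶠ b in U, M.rel b a) →
        ∃ z, M'.rel z (e a) ∧ ∀ φ ∈ L.lang Θ, (L.Sat M' z φ ↔ ∀ᶠ b in U, L.Sat M b φ)) := by
  obtain ⟨Θ', hΘ, n, hn, hexp⟩ := exists_expansion hext Θ (Ultrafilter W ⊕ Ultrafilter W)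
  -- The first letter of `U` holds above `f U`, the second fails exactly below `f U`. By
  -- antisymmetry, the first without the second holds at `f U` alone, so the two letters together
  -- act as a name.
  have hexp' : ∀ f : Ultrafilter W → W, ∃ M' : Model Θ' W, M'.rel = M.rel ∧
      (∀ φ ∈ L.lang Θ, ∀ a, L.Sat M' a φ ↔ L.Sat M a φ) ∧
      (∀ U a, L.Sat M' a (n (.inl U)) ↔ M.rel (f U) a) ∧
      ∀ U a, L.Sat M' a (n (.inr U)) ↔ ¬ M.rel a (f U) := by
    intro f
    obtain ⟨M', h1, h2, h3⟩ := hexp M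
      (Sum.elim (fun U => {a | M.rel (f U) a}) fun U => {a | ¬ M.rel a (f U)}) (by
        rintro (U | U) a b hab ha
        exacts [M.rel_trans _ _ _ ha hab, fun hb => ha (M.rel_trans _ _ _ hab hb)])
    exact ⟨M', h1, h2, fun U a => h3 (.inl U) a, fun U a => h3 (.inr U) a⟩
  choose K hKrel hKsat hKP hKQ using hexp'
  have hP : ∀ U, n (.inl U) ∈ L.lang Θ' := fun U => hn _
  have hQ : ∀ U, n (.inr U) ∈ L.lang Θ' := fun U => hn _
  have hlang := L.lang_mono Θ Θ' hΘ
  set P : Ultrafilter W → L.Form := fun U => n (.inl U)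
  set Q : Ultrafilter W → L.Form := fun U => n (.inr U)
  -- Along `F` each value `f U` is generic for `U`; in particular `f (pure a) = a` eventually.
  let F : Filter (Ultrafilter W → W) := Filter.pi fun U => (U : Filter W)
  -- Validity is required at all worlds, not just at `r`; this closes `G` under `box`.
  let G : Set L.Form := {χ | χ ∈ L.lang Θ' ∧ ∀ᶠ f in F, ∀ a, L.Sat (K f) a χ}
  -- a model of the formulas that are eventually valid
  obtain ⟨W₀, N₀, x₀, hΓ, hΔ⟩ : L.Satisfiable Θ' (insert (P (pure r)) G) {Q (pure r)} := by
    refine hcomp Θ' _ _ (Set.insert_subset (hP _) fun χ h => h.1)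
      (Set.singleton_subset_iff.2 (hQ _)) fun Γ' Δ' hΓ' hfin hΔ' _ => ?_
    have h1 : ∀ᶠ f in F, ∀ χ ∈ Γ', χ ∈ G → ∀ a, L.Sat (K f) a χ := by
      refine (Filter.eventually_all_finite hfin).2 fun χ _ => ?_
      by_cases hχ : χ ∈ G
      · exact hχ.2.mono fun f hf _ => hf
      · exact .of_forall fun f h => (hχ h).elim
    have h2 : ∀ᶠ f in F, f (pure r) = r :=
      Filter.Eventually.eval_pi (i := pure r) (p := fun _ x => x = r) (Filter.eventually_pure.2 rfl)
    obtain ⟨f, hf, hfr⟩ := (h1.and h2).exists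
    refine ⟨W, K f, r, fun χ hχ => ?_, fun χ hχ => ?_⟩
    · rcases hΓ' hχ with rfl | hG
      · exact ⟨hP _, (hKP _ _ _).2 (hfr.symm ▸ M.rel_refl _)⟩
      · exact ⟨hG.1, hf χ hχ hG r⟩
    · obtain rfl : χ = Q (pure r) := hΔ' hχ
      exact ⟨hQ _, fun h => (hKQ _ _ _).1 h (hfr.symm ▸ M.rel_refl _)⟩
  -- the closure properties of the set of eventually valid formulas
  have hbox : ∀ χ ∈ G, L.box χ ∈ G := fun χ hχ =>
    ⟨L.box_mem hχ.1, hχ.2.mono fun f hf a => (L.sat_box _ _ hχ.1).2 fun _ c _ _ => hf c⟩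
  have himp : ∀ φ ∈ L.lang Θ', ∀ ψ ∈ L.lang Θ',
      (∀ᶠ f in F, ∀ a, L.Sat (K f) a φ → L.Sat (K f) a ψ) → L.impl φ ψ ∈ G := by
    refine fun φ hφ ψ hψ h => ⟨L.impl_mem _ _ hφ _ hψ, h.mono fun f hf a => ?_⟩
    exact (L.sat_impl _ _ _ hφ _ hψ).2 fun b _ => (Classical.em _).symm.imp_right (hf b)
  have hev : ∀ (U : Ultrafilter W) (p : W → Prop), (∀ᶠ b in U, p b) → ∀ᶠ f in F, p (f U) :=
    fun U p h => Filter.Eventually.eval_pi (i := U) (p := fun _ x => p x) h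
  have hpure : ∀ a : W, ∀ᶠ f in F, f (pure a) = a := fun a =>
    hev (pure a) (fun x => x = a) (Filter.eventually_pure.2 rfl)
  -- The unravelling makes the new model projective again, so that the construction can be iterated.
  let N := N₀.unravel x₀
  -- As `G` is closed under `box`, it spreads both upwards and downwards.
  have hGP : ∀ s t, N.rel s t ∨ N.rel t s → (∀ χ ∈ G, L.Sat N s χ) → ∀ χ ∈ G, L.Sat N t χ := by
    intro s t hst hs χ hχ
    have := (L.sat_box N s hχ.1).1 (hs _ (hbox χ hχ))
    exact hst.elim (fun h => this t t h (N.rel_refl t)) (this s t (N.rel_refl s))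
  have hmp : ∀ s, (∀ χ ∈ G, L.Sat N s χ) → ∀ φ ∈ L.lang Θ', ∀ ψ ∈ L.lang Θ', L.impl φ ψ ∈ G →
      L.Sat N s φ → L.Sat N s ψ := fun s hs φ hφ ψ hψ h h' =>
    ((L.sat_impl N s _ hφ _ hψ).1 (hs _ h) s (N.rel_refl s)).resolve_left fun hn => hn h'
  let R : Ultrafilter W → (Σ a, N₀.Path x₀ a) → Prop := fun U s =>
    (∀ χ ∈ G, L.Sat N s χ) ∧ L.Sat N s (P U) ∧ ¬ L.Sat N s (Q U)
  have hRup : ∀ a s (U : Ultrafilter W), (∀ᶠ b in U, M.rel a b) → R (pure a) s →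
      ∃ t, N.rel s t ∧ R U t := by
    rintro a s U hU ⟨hG, -, hq⟩
    -- A world below `a` lies below `f U`, where `P U → Q U` fails. Hence a world of `N` that
    -- refutes `Q (pure a)` has a candidate for `U` above it.
    have hmem : L.impl (L.impl (P U) (Q U)) (Q (pure a)) ∈ G := by
      refine himp _ (L.impl_mem _ _ (hP U) _ (hQ U)) _ (hQ _) ?_
      filter_upwards [hev U _ hU, hpure a] with f hf ha c hc
      refine (hKQ _ _ _).2 fun hca => ?_
      rw [ha] at hca
      rcases (L.sat_impl _ _ _ (hP U) _ (hQ U)).1 hc (f U)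
        (by rw [hKrel]; exact M.rel_trans _ _ _ hca hf) with h | h
      exacts [h ((hKP _ _ _).2 (M.rel_refl _)), (hKQ _ _ _).1 h (M.rel_refl _)]
    have hni : ¬ L.Sat N s (L.impl (P U) (Q U)) := fun h =>
      hq (hmp s hG _ (L.impl_mem _ _ (hP U) _ (hQ U)) _ (hQ _) hmem h)
    rw [L.sat_impl _ _ _ (hP U) _ (hQ U)] at hni
    push Not at hni
    obtain ⟨t, hst, h1, h2⟩ := hni
    exact ⟨t, hst, hGP s t (.inl hst) hG, h1, h2⟩
  have hRdown : ∀ a s (U : Ultrafilter W), (∀ᶠ b in U, M.rel b a) → R (pure a) s →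
      ∃ t, N.rel t s ∧ R U t := by
    rintro a s U hU ⟨hG, hp, -⟩
    have hmem : L.impl (P (pure a)) (L.coimpl (P U) (Q U)) ∈ G := by
      refine himp _ (hP _) _ (L.coimpl_mem _ _ (hP U) _ (hQ U)) ?_
      filter_upwards [hev U _ hU, hpure a] with f hf ha c hc
      have hac := (hKP _ _ _).1 hc
      rw [ha] at hac
      refine (L.sat_coimpl _ _ _ (hP U) _ (hQ U)).2 ⟨f U, ?_, ?_, ?_⟩
      · rw [hKrel]
        exact M.rel_trans _ _ _ hf hac
      · exact (hKP _ _ _).2 (M.rel_refl _)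
      · exact fun h => (hKQ _ _ _).1 h (M.rel_refl _)
    obtain ⟨t, hst, h1, h2⟩ := (L.sat_coimpl _ _ _ (hP U) _ (hQ U)).1
      (hmp s hG _ (hP _) _ (L.coimpl_mem _ _ (hP U) _ (hQ U)) hmem hp)
    exact ⟨t, hst, hGP s t (.inr hst) hG, h1, h2⟩
  -- By persistence, `P U → φ` is in `G` if `φ` holds along `U`, and `φ → Q U` is in `G` otherwise.
  have hRsat : ∀ (U : Ultrafilter W) s, R U s → ∀ φ ∈ L.lang Θ,
      (L.Sat (N.reduct hΘ) s φ ↔ ∀ᶠ b in U, L.Sat M b φ) := by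
    rintro U s ⟨hG, hp, hq⟩ φ hφ
    rw [← L.expansion hΘ N s φ hφ]
    constructor
    · intro hs
      by_contra hU
      rw [← Ultrafilter.eventually_not] at hU
      refine hq (hmp s hG φ (hlang hφ) _ (hQ U) (himp _ (hlang hφ) _ (hQ U) ?_) hs)
      filter_upwards [hev U _ hU] with f hf c hc
      refine (hKQ _ _ _).2 fun hcf => hf ?_
      exact hpres.sat_mono M hcf hφ ((hKsat f φ hφ c).1 hc)
    · intro hU
      refine hmp s hG _ (hP U) φ (hlang hφ) (himp _ (hP U) _ (hlang hφ) ?_) hp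
      filter_upwards [hev U _ hU] with f hf c hc
      exact (hKsat f φ hφ c).2 (hpres.sat_mono M ((hKP _ _ _).1 hc) hφ hf)
  have hroot : ∀ χ ∈ L.lang Θ', (L.Sat N ⟨x₀, .nil⟩ χ ↔ L.Sat N₀ x₀ χ) := fun χ hχ =>
    N₀.sat_unravel_iff hpres x₀ ⟨x₀, .nil⟩ hχ
  -- Projectivity selects one candidate for each old world; the zigzag conditions are `hRup` and
  -- `hRdown` at principal ultrafilters.
  obtain ⟨e, heR, he⟩ := hM _ N.rel N.rel_refl N.rel_trans (fun a s => R (pure a) s)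
    ⟨⟨x₀, .nil⟩, fun χ hχ => (hroot χ hχ.1).2 (hΓ (Set.mem_insert_of_mem _ hχ)).2,
      (hroot _ (hP _)).2 (hΓ (Set.mem_insert _ _)).2, fun h => (hΔ rfl).2 ((hroot _ (hQ _)).1 h)⟩
    (fun a b s hab => hRup a s (pure b) (Filter.eventually_pure.2 hab))
    (fun a b s hab => hRdown a s (pure b) (Filter.eventually_pure.2 hab))
  refine ⟨_, N.reduct hΘ, ⟨x₀, .nil⟩, e, N₀.projective_unravel x₀, fun a b => ⟨he a b, ?_⟩, ?_, ?_,
    ?_⟩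
  · intro hN
    by_contra hab
    -- If `a` is not below `b`, no world is both above `a` and below `b`.
    have hmem : L.impl (P (pure a)) (Q (pure b)) ∈ G := by
      refine himp _ (hP _) _ (hQ _) ?_
      filter_upwards [hpure a, hpure b] with f ha hb c hc
      have hac := (hKP _ _ _).1 hc
      rw [ha] at hac
      refine (hKQ _ _ _).2 fun hcb => hab ?_
      rw [hb] at hcb
      exact M.rel_trans _ _ _ hac hcb
    exact (heR b).2.2 (hpres.sat_mono N hN (hQ _)
      (hmp _ (heR a).1 _ (hP _) _ (hQ _) hmem (heR a).2.1))
  · intro φ hφ a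
    rw [hRsat (pure a) (e a) (heR a) φ hφ]
    exact Filter.eventually_pure.symm
  · intro a U hU
    obtain ⟨t, h, ht⟩ := hRup a (e a) U hU (heR a)
    exact ⟨t, h, hRsat U t ht⟩
  · intro a U hU
    obtain ⟨t, h, ht⟩ := hRdown a (e a) U hU (heR a)
    exact ⟨t, h, hRsat U t ht⟩

/-! ### Limits of elementary chains -/

/-- Every sequence of injections has a limit. -/
theorem exists_limit_of_injective (W : ℕ → Type u) (e : ∀ n, W n → W (n + 1))
    (he : ∀ n, Function.Injective (e n)) :
    ∃ (A : Type u) (i : ∀ n, W n → A), (∀ n, Function.Injective (i n)) ∧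
      ∀ n a, i (n + 1) (e n a) = i n a := by
  let f : ∀ m n : ℕ, m ≤ n → (W m ↪ W n) := fun m n h =>
    ⟨Nat.leRecOn h @fun k => e k, Nat.leRecOn_injective h _ he⟩
  have : DirectedSystem W (f · · ·) :=
    ⟨fun _ _ => Nat.leRecOn_self _, fun _ _ _ hij hjk _ => (Nat.leRecOn_trans hij hjk _).symm⟩
  refine ⟨DirectLimit W f, fun n a => ⟦⟨n, a⟩⟧,
    fun n => DirectLimit.mk_injective f (fun i j h => (f i j h).injective) n, fun n a => ?_⟩
  refine Eq.trans ?_ (DirectLimit.mk_apply (f := f) n (n + 1) a n.le_succ)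
  exact congrArg (fun b => (⟦⟨n + 1, b⟩⟧ : DirectLimit W f))
    (Nat.leRecOn_succ' (next := @fun k => e k) a).symm

/-- The copy of a model along a bijection of its set of worlds. -/
def Model.copy {U : Type u} (M : Model Θ W) (g : W ≃ U) : Model Θ U where
  nonempty := M.nonempty.map g
  rel a b := M.rel (g.symm a) (g.symm b)
  rel_refl _ := M.rel_refl _
  rel_trans _ _ _ := M.rel_trans _ _ _
  rel_antisymm _ _ h h' := g.symm.injective (M.rel_antisymm _ _ h h')
  val p := {a | g.symm a ∈ M.val p}
  val_mono p _ _ := M.val_mono p _ _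

theorem Model.isIso_copy {U : Type u} (M : Model Θ W) (g : W ≃ U) : M.IsIso (M.copy g) g :=
  ⟨fun a b => by simp [copy], fun p a => by simp [copy]⟩

/-- A sequence of elementary embeddings has an elementary limit. -/
theorem exists_elementary_limit {L : AbstractLogic.{u, v}} (hext : BIL.{u}.ExtendedBy L)
    (htup : L.TarskiUnionProperty) (W : ℕ → Type u) (M : ∀ n, Model Θ (W n))
    (e : ∀ n, W n → W (n + 1)) (hrel : ∀ n a b, (M n).rel a b ↔ (M (n + 1)).rel (e n a) (e n b))
    (hsat : ∀ n, ∀ φ ∈ L.lang Θ, ∀ a, L.Sat (M n) a φ ↔ L.Sat (M (n + 1)) (e n a) φ) :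
    ∃ (W' : Type u) (M' : Model Θ W') (i : ∀ n, W n → W'),
      (∀ n a b, (M n).rel a b ↔ M'.rel (i n a) (i n b)) ∧
      (∀ n, ∀ φ ∈ L.lang Θ, ∀ a, L.Sat (M n) a φ ↔ L.Sat M' (i n a) φ) ∧
      (∀ n a, i (n + 1) (e n a) = i n a) ∧ ∀ x, ∃ n a, i n a = x := by
  -- Maps that reflect a partial order are injective.
  obtain ⟨A, i, hi, hie⟩ := exists_limit_of_injective W e fun n a b h =>
    (M n).rel_antisymm _ _ ((hrel n a b).2 (h ▸ (M (n + 1)).rel_refl _))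
      ((hrel n b a).2 (h ▸ (M (n + 1)).rel_refl _))
  -- The Tarski Union Property concerns genuine submodels in one ambient set, so each model is
  -- copied onto its image in the limit.
  let S : ℕ → Set A := fun n => Set.range (i n)
  let g : ∀ n, W n ≃ S n := fun n => Equiv.ofInjective (i n) (hi n)
  let N : ∀ n, Model Θ (S n) := fun n => (M n).copy (g n)
  have hg : ∀ n, (M n).IsIso (N n) (g n) := fun n => (M n).isIso_copy (g n)
  have hS : ∀ n, S n ⊆ S (n + 1) := by
    rintro n _ ⟨a, rfl⟩
    exact ⟨e n a, hie n a⟩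
  have hinc : ∀ n a, Set.inclusion (hS n) (g n a) = g (n + 1) (e n a) := fun n a =>
    Subtype.ext (hie n a).symm
  have hsatN : ∀ n, ∀ φ ∈ L.lang Θ, ∀ a, L.Sat (N n) (g n a) φ ↔ L.Sat (M n) a φ :=
    fun n φ hφ a => (L.isomorphism _ _ (g n) (hg n) a φ hφ).symm
  -- Letters are expressible in `L`, so preservation of `L`-truth determines the valuation.
  have hval : ∀ n p a, a ∈ (M n).val p ↔ e n a ∈ (M (n + 1)).val p := by
    intro n p a
    obtain ⟨ψ, hψ, h⟩ := hext.exists_letter p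
    rw [← h, ← h]
    exact hsat n ψ hψ a
  have hel : ∀ n, L.IsElemSubmodel (N n) (N (n + 1)) := by
    intro n
    refine ⟨⟨hS n, fun a b => ?_, fun p a => ?_⟩, fun a => ?_⟩
    · obtain ⟨a, rfl⟩ := (g n).surjective a
      obtain ⟨b, rfl⟩ := (g n).surjective b
      rw [hinc, hinc, ← (hg n).rel_iff, ← (hg (n + 1)).rel_iff]
      exact hrel n a b
    · obtain ⟨a, rfl⟩ := (g n).surjective a
      rw [hinc, ← (hg n).val_iff, ← (hg (n + 1)).val_iff]
      exact hval n p a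
    · obtain ⟨a, rfl⟩ := (g n).surjective a
      rw [hinc]
      have : ∀ φ ∈ L.lang Θ, (L.Sat (N n) (g n a) φ ↔ L.Sat (N (n + 1)) (g (n + 1) (e n a)) φ) :=
        fun φ hφ => by rw [hsatN n φ hφ, hsatN (n + 1) φ hφ, hsat n φ hφ]
      exact ⟨Set.ext fun φ => and_congr_right (this φ),
        Set.ext fun φ => and_congr_right fun hφ => not_congr (this φ hφ)⟩
  have hlim := htup Θ A S N hel
  refine ⟨_, Model.iUnion S N fun k => (hel k).1,
    fun n a => Set.inclusion (hlim n).1.subset (g n a), fun n a b => ?_, fun n φ hφ a => ?_,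
    fun n a => Subtype.ext (hie n a), ?_⟩
  · rw [(hg n).rel_iff]
    exact (hlim n).1.rel_iff _ _
  · rw [← hsatN n φ hφ]
    have := Set.ext_iff.1 ((hlim n).2 (g n a)).1 φ
    exact ⟨fun h => (this.1 ⟨hφ, h⟩).2, fun h => (this.2 ⟨hφ, h⟩).2⟩
  · rintro ⟨x, hx⟩
    obtain ⟨n, a, rfl⟩ := Set.mem_iUnion.1 hx
    exact ⟨n, a, rfl⟩

/-! ### Finite types and saturation -/

/-- Finite conjunctions of formulas that are definable in `K` are definable in `K`. -/
theorem exists_finite_conj (L : AbstractLogic.{u, v}) (K : AbstractLogic.{u, w}) {Γ : Set L.Form}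
    (hfin : Γ.Finite) (hΓ : ∀ χ ∈ Γ, ∃ ψ ∈ K.lang Θ, ∀ (W : Type u) (M : Model Θ W) (a : W),
      L.Sat M a χ ↔ K.Sat M a ψ) :
    ∃ ψ ∈ K.lang Θ, ∀ (W : Type u) (M : Model Θ W) (a : W),
      (∀ χ ∈ Γ, L.Sat M a χ) ↔ K.Sat M a ψ := by
  induction Γ, hfin using Set.Finite.induction_on with
  | empty => exact ⟨K.top, K.top_mem Θ, fun W M a => by simp [K.sat_top]⟩
  | insert _ _ ih =>
    obtain ⟨ψ, hψ, h⟩ := ih fun χ hχ => hΓ χ (Set.mem_insert_of_mem _ hχ)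
    obtain ⟨ψ', hψ', h'⟩ := hΓ _ (Set.mem_insert _ _)
    refine ⟨K.conj ψ' ψ, K.conj_mem _ _ hψ' _ hψ, fun W M a => ?_⟩
    rw [K.sat_conj M a _ hψ' _ hψ, Set.forall_mem_insert, h', h]

/-- Finite disjunctions of formulas that are definable in `K` are definable in `K`. -/
theorem exists_finite_disj (L : AbstractLogic.{u, v}) (K : AbstractLogic.{u, w}) {Γ : Set L.Form}
    (hfin : Γ.Finite) (hΓ : ∀ χ ∈ Γ, ∃ ψ ∈ K.lang Θ, ∀ (W : Type u) (M : Model Θ W) (a : W),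
      L.Sat M a χ ↔ K.Sat M a ψ) :
    ∃ ψ ∈ K.lang Θ, ∀ (W : Type u) (M : Model Θ W) (a : W),
      (∃ χ ∈ Γ, L.Sat M a χ) ↔ K.Sat M a ψ := by
  induction Γ, hfin using Set.Finite.induction_on with
  | empty => exact ⟨K.bot, K.bot_mem Θ, fun W M a => by simp [K.sat_bot]⟩
  | insert _ _ ih =>
    obtain ⟨ψ, hψ, h⟩ := ih fun χ hχ => hΓ χ (Set.mem_insert_of_mem _ hχ)
    obtain ⟨ψ', hψ', h'⟩ := hΓ _ (Set.mem_insert _ _)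
    refine ⟨K.disj ψ' ψ, K.disj_mem _ _ hψ' _ hψ, fun W M a => ?_⟩
    rw [K.sat_disj M a _ hψ' _ hψ, Set.exists_mem_insert, h', h]

/-- Whether a finite type is realized above, or below, a world is expressible in the logic. -/
theorem AbstractLogic.exists_realization_formulas (K : AbstractLogic.{u, v}) {Γ Δ : Set K.Form}
    (hΓ : Γ ⊆ K.lang Θ) (hΓfin : Γ.Finite) (hΔ : Δ ⊆ K.lang Θ) (hΔfin : Δ.Finite) :
    ∃ φ ∈ K.lang Θ, ∃ ψ ∈ K.lang Θ, ∀ (W : Type u) (M : Model Θ W) (a : W),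
      (¬ K.Sat M a φ ↔
        ∃ b, M.rel a b ∧ (∀ γ ∈ Γ, K.Sat M b γ) ∧ ∀ δ ∈ Δ, ¬ K.Sat M b δ) ∧
      (K.Sat M a ψ ↔
        ∃ b, M.rel b a ∧ (∀ γ ∈ Γ, K.Sat M b γ) ∧ ∀ δ ∈ Δ, ¬ K.Sat M b δ) := by
  obtain ⟨γ, hγ, h⟩ := exists_finite_conj K K hΓfin
    fun χ hχ => ⟨χ, hΓ hχ, fun _ _ _ => Iff.rfl⟩
  obtain ⟨δ, hδ, h'⟩ := exists_finite_disj K K hΔfin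
    fun χ hχ => ⟨χ, hΔ hχ, fun _ _ _ => Iff.rfl⟩
  refine ⟨K.impl γ δ, K.impl_mem _ _ hγ _ hδ, K.coimpl γ δ, K.coimpl_mem _ _ hγ _ hδ,
    fun W M a => ⟨?_, ?_⟩⟩
  · rw [K.sat_impl M a _ hγ _ hδ]
    simp only [← h, ← h']
    push Not
    rfl
  · rw [K.sat_coimpl M a _ hγ _ hδ]
    simp only [← h, ← h']
    push Not
    rfl

/-- A model is saturated for `K` if every type that is finitely satisfiable in the worlds above,
or below, a given world is realized there. -/
structure AbstractLogic.IsSaturated (K : AbstractLogic.{u, v}) (M : Model Θ W) : Prop where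
  up : ∀ a, ∀ Γ ⊆ K.lang Θ, ∀ Δ ⊆ K.lang Θ,
    (∀ Γ' ⊆ Γ, Γ'.Finite → ∀ Δ' ⊆ Δ, Δ'.Finite →
      ∃ b, M.rel a b ∧ (∀ γ ∈ Γ', K.Sat M b γ) ∧ ∀ δ ∈ Δ', ¬ K.Sat M b δ) →
    ∃ b, M.rel a b ∧ (∀ γ ∈ Γ, K.Sat M b γ) ∧ ∀ δ ∈ Δ, ¬ K.Sat M b δ
  down : ∀ a, ∀ Γ ⊆ K.lang Θ, ∀ Δ ⊆ K.lang Θ,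
    (∀ Γ' ⊆ Γ, Γ'.Finite → ∀ Δ' ⊆ Δ, Δ'.Finite →
      ∃ b, M.rel b a ∧ (∀ γ ∈ Γ', K.Sat M b γ) ∧ ∀ δ ∈ Δ', ¬ K.Sat M b δ) →
    ∃ b, M.rel b a ∧ (∀ γ ∈ Γ, K.Sat M b γ) ∧ ∀ δ ∈ Δ, ¬ K.Sat M b δ

/-- A finitely satisfiable type is the limit type of an ultrafilter. -/
theorem exists_ultrafilter_of_finitely_satisfiable {α : Type u} {ι : Type w} (p : α → Prop)
    (S : α → ι → Prop) (Γ Δ : Set ι)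
    (h : ∀ Γ' ⊆ Γ, Γ'.Finite → ∀ Δ' ⊆ Δ, Δ'.Finite →
      ∃ b, p b ∧ (∀ γ ∈ Γ', S b γ) ∧ ∀ δ ∈ Δ', ¬ S b δ) :
    ∃ U : Ultrafilter α, (∀ᶠ b in U, p b) ∧ (∀ γ ∈ Γ, ∀ᶠ b in U, S b γ) ∧
      ∀ δ ∈ Δ, ∀ᶠ b in U, ¬ S b δ := by
  let F : Filter α :=
    { sets := {s | ∃ Γ' ⊆ Γ, Γ'.Finite ∧ ∃ Δ' ⊆ Δ, Δ'.Finite ∧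
        ∀ b, p b → (∀ γ ∈ Γ', S b γ) → (∀ δ ∈ Δ', ¬ S b δ) → b ∈ s}
      univ_sets := ⟨∅, Set.empty_subset _, Set.finite_empty, ∅, Set.empty_subset _,
        Set.finite_empty, fun _ _ _ _ => trivial⟩
      sets_of_superset := by
        rintro s t ⟨Γ', h1, h2, Δ', h3, h4, h5⟩ hst
        exact ⟨Γ', h1, h2, Δ', h3, h4, fun b hb hb' hb'' => hst (h5 b hb hb' hb'')⟩
      inter_sets := by
        rintro s t ⟨Γ₁, h1, h2, Δ₁, h3, h4, h5⟩ ⟨Γ₂, k1, k2, Δ₂, k3, k4, k5⟩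
        exact ⟨Γ₁ ∪ Γ₂, Set.union_subset h1 k1, h2.union k2, Δ₁ ∪ Δ₂, Set.union_subset h3 k3,
          h4.union k4, fun b hb hb' hb'' =>
            ⟨h5 b hb (fun γ hγ => hb' γ (.inl hγ)) fun δ hδ => hb'' δ (.inl hδ),
              k5 b hb (fun γ hγ => hb' γ (.inr hγ)) fun δ hδ => hb'' δ (.inr hδ)⟩⟩ }
  have : F.NeBot := by
    refine ⟨fun hF => ?_⟩
    obtain ⟨Γ', h1, h2, Δ', h3, h4, h5⟩ := Filter.empty_mem_iff_bot.2 hF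
    obtain ⟨b, hb, hb', hb''⟩ := h Γ' h1 h2 Δ' h3 h4
    exact h5 b hb hb' hb''
  refine ⟨.of F, Ultrafilter.of_le F ?_, fun γ hγ => Ultrafilter.of_le F ?_,
    fun δ hδ => Ultrafilter.of_le F ?_⟩
  · exact ⟨∅, Set.empty_subset _, Set.finite_empty, ∅, Set.empty_subset _,
      Set.finite_empty, fun _ h _ _ => h⟩
  · exact ⟨{γ}, Set.singleton_subset_iff.2 hγ, Set.finite_singleton _, ∅, Set.empty_subset _,
      Set.finite_empty, fun _ _ h _ => h _ rfl⟩
  · exact ⟨∅, Set.empty_subset _, Set.finite_empty, {δ}, Set.singleton_subset_iff.2 hδ,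
      Set.finite_singleton _, fun _ _ _ h => h _ rfl⟩

/-- Every pointed model is equivalent to one that is saturated for `BIL`. -/
theorem exists_saturated {L : AbstractLogic.{u, v}} (hext : BIL.{u}.ExtendedBy L)
    (hpres : L.PreservedUnderBiasimulations) (hcomp : L.StarCompact)
    (htup : L.TarskiUnionProperty) (M : Model Θ W) (a : W) :
    ∃ (W' : Type u) (M' : Model Θ W') (a' : W'), BIL.IsSaturated M' ∧
      ∀ φ ∈ L.lang Θ, (L.Sat M a φ ↔ L.Sat M' a' φ) := by
  -- The root and its projectivity are carried along as the input for the next step.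
  let T := Σ' (W : Type u) (M : Model Θ W) (r : W), M.Projective r
  have hstep : ∀ t : T, ∃ (t' : T) (e : t.1 → t'.1),
      (∀ a b, t.2.1.rel a b ↔ t'.2.1.rel (e a) (e b)) ∧
      (∀ φ ∈ L.lang Θ, ∀ a, L.Sat t.2.1 a φ ↔ L.Sat t'.2.1 (e a) φ) ∧
      (∀ a, ∀ U : Ultrafilter t.1, (∀ᶠ b in U, t.2.1.rel a b) → ∃ z, t'.2.1.rel (e a) z ∧
        ∀ φ ∈ L.lang Θ, (L.Sat t'.2.1 z φ ↔ ∀ᶠ b in U, L.Sat t.2.1 b φ)) ∧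
      (∀ a, ∀ U : Ultrafilter t.1, (∀ᶠ b in U, t.2.1.rel b a) → ∃ z, t'.2.1.rel z (e a) ∧
        ∀ φ ∈ L.lang Θ, (L.Sat t'.2.1 z φ ↔ ∀ᶠ b in U, L.Sat t.2.1 b φ)) := by
    rintro ⟨W, M, r, hM⟩
    obtain ⟨W', M', r', e, hM', h⟩ := exists_ultrafilter_extension hext hpres hcomp M r hM
    exact ⟨⟨W', M', r', hM'⟩, e, h⟩
  choose next e hrel hsat hup hdown using hstep
  let t : ℕ → T := fun n =>
    Nat.rec ⟨_, M.unravel a, _, M.projective_unravel a⟩ (fun _ t => next t) n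
  obtain ⟨W', M', i, hirel, hisat, hie, hi⟩ := exists_elementary_limit hext htup
    (fun n => (t n).1) (fun n => (t n).2.1) (fun n => e (t n)) (fun n => hrel (t n))
    (fun n => hsat (t n))
  have hsatBIL : ∀ n, ∀ φ ∈ BIL.lang Θ, ∀ b, BIL.Sat (t n).2.1 b φ ↔ BIL.Sat M' (i n b) φ := by
    intro n φ hφ b
    obtain ⟨ψ, hψ, h⟩ := hext Θ φ hφ
    rw [h, h]
    exact hisat n ψ hψ b
  have hlim : ∀ n (U : Ultrafilter (t n).1) z, (∀ φ ∈ L.lang Θ,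
      (L.Sat (t (n + 1)).2.1 z φ ↔ ∀ᶠ b in U, L.Sat (t n).2.1 b φ)) → ∀ φ ∈ BIL.lang Θ,
      (BIL.Sat M' (i (n + 1) z) φ ↔ ∀ᶠ b in U, BIL.Sat (t n).2.1 b φ) := by
    intro n U z hz φ hφ
    obtain ⟨ψ, hψ, h⟩ := hext Θ φ hφ
    simp only [h]
    exact (hisat (n + 1) ψ hψ z).symm.trans (hz ψ hψ)
  refine ⟨W', M', i 0 ⟨a, .nil⟩, ⟨fun x Γ hΓ Δ hΔ hfin => ?_, fun x Γ hΓ Δ hΔ hfin => ?_⟩,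
    fun φ hφ => (M.sat_unravel_iff hpres a ⟨a, .nil⟩ hφ).symm.trans (hisat 0 φ hφ _)⟩
  · obtain ⟨n, v, rfl⟩ := hi x
    -- Realizing a finite type above `v` is expressible, so finite satisfiability descends from the
    -- limit to stage `n`. The resulting ultrafilter on stage `n` has its limit type realized at
    -- stage `n + 1`.
    obtain ⟨U, hU, hUΓ, hUΔ⟩ := exists_ultrafilter_of_finitely_satisfiable
      (fun b => (t n).2.1.rel v b) (fun b φ => BIL.Sat (t n).2.1 b φ) Γ Δ (by
        intro Γ' h1 h2 Δ' h3 h4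
        obtain ⟨φ, hφ, _, -, h⟩ :=
          BIL.exists_realization_formulas (h1.trans hΓ) h2 (h3.trans hΔ) h4
        refine (h _ _ v).1.1 ?_
        rw [hsatBIL n φ hφ]
        exact (h _ _ _).1.2 (hfin Γ' h1 h2 Δ' h3 h4))
    obtain ⟨z, hz, hzU⟩ := hup (t n) v U hU
    refine ⟨i (n + 1) z, ?_, fun γ hγ => (hlim n U z hzU γ (hΓ hγ)).2 (hUΓ γ hγ), fun δ hδ h =>
      Ultrafilter.eventually_not.1 (hUΔ δ hδ) ((hlim n U z hzU δ (hΔ hδ)).1 h)⟩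
    rw [← hie n v]
    exact (hirel (n + 1) _ _).1 hz
  · obtain ⟨n, v, rfl⟩ := hi x
    obtain ⟨U, hU, hUΓ, hUΔ⟩ := exists_ultrafilter_of_finitely_satisfiable
      (fun b => (t n).2.1.rel b v) (fun b φ => BIL.Sat (t n).2.1 b φ) Γ Δ (by
        intro Γ' h1 h2 Δ' h3 h4
        obtain ⟨_, -, φ, hφ, h⟩ :=
          BIL.exists_realization_formulas (h1.trans hΓ) h2 (h3.trans hΔ) h4
        refine (h _ _ v).2.1 ?_
        rw [hsatBIL n φ hφ]
        exact (h _ _ _).2.2 (hfin Γ' h1 h2 Δ' h3 h4))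
    obtain ⟨z, hz, hzU⟩ := hdown (t n) v U hU
    refine ⟨i (n + 1) z, ?_, fun γ hγ => (hlim n U z hzU γ (hΓ hγ)).2 (hUΓ γ hγ), fun δ hδ h =>
      Ultrafilter.eventually_not.1 (hUΔ δ hδ) ((hlim n U z hzU δ (hΔ hδ)).1 h)⟩
    rw [← hie n v]
    exact (hirel (n + 1) _ _).1 hz

/-! ### From theory inclusion to bi-asimulation -/

/-- Between saturated models, inclusion of `BIL`-theories is a bi-asimulation. -/
theorem isBiasimulation_of_isSaturated {W₁ W₂ : Type u} {M₁ : Model Θ W₁} {M₂ : Model Θ W₂}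
    (h₁ : BIL.IsSaturated M₁) (h₂ : BIL.IsSaturated M₂) {w₁ : W₁} {w₂ : W₂}
    (h : ∀ φ ∈ BIL.lang Θ, BIL.Sat M₁ w₁ φ → BIL.Sat M₂ w₂ φ) :
    IsBiasimulation M₁ w₁ M₂ w₂ (fun a s => ∀ φ ∈ BIL.lang Θ, BIL.Sat M₁ a φ → BIL.Sat M₂ s φ)
      (fun s a => ∀ φ ∈ BIL.lang Θ, BIL.Sat M₂ s φ → BIL.Sat M₁ a φ) := by
  have atom : ∀ {W₁ W₂ : Type u} (M₁ : Model Θ W₁) (M₂ : Model Θ W₂) p a s,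
      (∀ φ ∈ BIL.lang Θ, BIL.Sat M₁ a φ → BIL.Sat M₂ s φ) → a ∈ M₁.val p → s ∈ M₂.val p := by
    intro W₁ W₂ M₁ M₂ p a s h ha
    obtain ⟨_, hs⟩ := h (.letter p.1) (Set.singleton_subset_iff.2 p.2) ⟨p.2, ha⟩
    exact hs
  have back : ∀ {W₁ W₂ : Type u} {M₁ : Model Θ W₁} {M₂ : Model Θ W₂}, BIL.IsSaturated M₁ →
      ∀ a s t, (∀ φ ∈ BIL.lang Θ, BIL.Sat M₁ a φ → BIL.Sat M₂ s φ) → M₂.rel s t →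
        ∃ b, M₁.rel a b ∧ (∀ φ ∈ BIL.lang Θ, BIL.Sat M₂ t φ → BIL.Sat M₁ b φ) ∧
          ∀ φ ∈ BIL.lang Θ, BIL.Sat M₁ b φ → BIL.Sat M₂ t φ := by
    intro W₁ W₂ M₁ M₂ h₁ a s t has hst
    obtain ⟨b, hb, hΓ, hΔ⟩ := h₁.up a _ (fun φ (hφ : φ ∈ BIL.thPos M₂ t) => hφ.1)
      _ (fun φ (hφ : φ ∈ BIL.thNeg M₂ t) => hφ.1) (by
        intro Γ' h1 h2 Δ' h3 h4
        obtain ⟨φ, hφ, _, -, h⟩ := BIL.exists_realization_formulas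
          (fun γ hγ => (h1 hγ).1) h2 (fun δ hδ => (h3 hδ).1) h4
        -- If nothing above `a` realized the finite type, the implication saying so would pass from
        -- `a` to `s`, where `t` refutes it.
        refine (h _ _ a).1.1 fun ha => ?_
        exact (h _ _ s).1.2 ⟨t, hst, fun γ hγ => (h1 hγ).2, fun δ hδ => (h3 hδ).2⟩ (has φ hφ ha))
    exact ⟨b, hb, fun φ hφ ht => hΓ φ ⟨hφ, ht⟩, fun φ hφ hb => by_contra fun ht =>
      hΔ φ ⟨hφ, ht⟩ hb⟩
  have forth : ∀ {W₁ W₂ : Type u} {M₁ : Model Θ W₁} {M₂ : Model Θ W₂}, BIL.IsSaturated M₂ →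
      ∀ a b s, (∀ φ ∈ BIL.lang Θ, BIL.Sat M₁ a φ → BIL.Sat M₂ s φ) → M₁.rel b a →
        ∃ t, M₂.rel t s ∧ (∀ φ ∈ BIL.lang Θ, BIL.Sat M₂ t φ → BIL.Sat M₁ b φ) ∧
          ∀ φ ∈ BIL.lang Θ, BIL.Sat M₁ b φ → BIL.Sat M₂ t φ := by
    intro W₁ W₂ M₁ M₂ h₂ a b s has hba
    obtain ⟨t, ht, hΓ, hΔ⟩ := h₂.down s _ (fun φ (hφ : φ ∈ BIL.thPos M₁ b) => hφ.1)
      _ (fun φ (hφ : φ ∈ BIL.thNeg M₁ b) => hφ.1) (by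
        intro Γ' h1 h2 Δ' h3 h4
        obtain ⟨_, -, φ, hφ, h⟩ := BIL.exists_realization_formulas
          (fun γ hγ => (h1 hγ).1) h2 (fun δ hδ => (h3 hδ).1) h4
        -- Downwards, realizability is itself a formula, a co-implication, and passes from `a` to
        -- `s` directly.
        refine (h _ _ s).2.1 (has φ hφ ?_)
        exact (h _ _ a).2.2 ⟨b, hba, fun γ hγ => (h1 hγ).2, fun δ hδ => (h3 hδ).2⟩)
    exact ⟨t, ht, fun φ hφ ht => by_contra fun hb => hΔ φ ⟨hφ, hb⟩ ht,
      fun φ hφ hb => hΓ φ ⟨hφ, hb⟩⟩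
  exact ⟨h, atom M₁ M₂, atom M₂ M₁, back h₁, back h₂, forth h₂, forth h₁⟩

/-- The truth of formulas of `L` is preserved under inclusion of `BIL`-theories. -/
theorem sat_of_forall_BIL {L : AbstractLogic.{u, v}} (hext : BIL.{u}.ExtendedBy L)
    (hpres : L.PreservedUnderBiasimulations) (hcomp : L.StarCompact)
    (htup : L.TarskiUnionProperty) {W₁ W₂ : Type u} (M₁ : Model Θ W₁) (w₁ : W₁)
    (M₂ : Model Θ W₂) (w₂ : W₂) (h : ∀ φ ∈ BIL.lang Θ, BIL.Sat M₁ w₁ φ → BIL.Sat M₂ w₂ φ)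
    {φ : L.Form} (hφ : φ ∈ L.lang Θ) (hw : L.Sat M₁ w₁ φ) : L.Sat M₂ w₂ φ := by
  obtain ⟨U₁, N₁, v₁, hN₁, hv₁⟩ := exists_saturated hext hpres hcomp htup M₁ w₁
  obtain ⟨U₂, N₂, v₂, hN₂, hv₂⟩ := exists_saturated hext hpres hcomp htup M₂ w₂
  refine (hv₂ φ hφ).2 (hpres Θ U₁ U₂ N₁ v₁ N₂ v₂ _ _
    (isBiasimulation_of_isSaturated hN₁ hN₂ fun χ hχ hs => ?_) ⟨hφ, (hv₁ φ hφ).1 hw⟩).2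
  obtain ⟨ψ, hψ, h'⟩ := hext Θ χ hχ
  rw [h', ← hv₂ ψ hψ, ← h']
  exact h χ hχ (by rwa [h', hv₁ ψ hψ, ← h'])

/-! ### Definability by compactness -/

/-- A formula of an extension of `BIL` whose truth is preserved under inclusion of `BIL`-theories
is equivalent to a formula of `BIL`, by compactness. -/
theorem exists_BIL_equiv {L : AbstractLogic.{u, v}} (hext : BIL.{u}.ExtendedBy L)
    (hcomp : L.StarCompact) {φ : L.Form} (hφ : φ ∈ L.lang Θ)
    (h : ∀ (W₁ W₂ : Type u) (M₁ : Model Θ W₁) (w₁ : W₁) (M₂ : Model Θ W₂) (w₂ : W₂),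
      (∀ χ ∈ BIL.lang Θ, BIL.Sat M₁ w₁ χ → BIL.Sat M₂ w₂ χ) →
        L.Sat M₁ w₁ φ → L.Sat M₂ w₂ φ) :
    ∃ ψ ∈ BIL.lang Θ, ∀ (W : Type u) (M : Model Θ W) (a : W), L.Sat M a φ ↔ BIL.Sat M a ψ := by
  let B : Set L.Form := {χ | χ ∈ L.lang Θ ∧ ∃ ψ ∈ BIL.lang Θ,
    ∀ (W : Type u) (M : Model Θ W) (a : W), L.Sat M a χ ↔ BIL.Sat M a ψ}
  have hB : ∀ ψ ∈ BIL.lang Θ, ∃ χ ∈ B, ∀ (W : Type u) (M : Model Θ W) (a : W),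
      L.Sat M a χ ↔ BIL.Sat M a ψ := by
    intro ψ hψ
    obtain ⟨χ, hχ, hψχ⟩ := hext Θ ψ hψ
    exact ⟨χ, ⟨hχ, ψ, hψ, fun W M a => (hψχ W M a).symm⟩, fun W M a => (hψχ W M a).symm⟩
  -- The `BIL`-definable consequences of `φ`; a finite part of them will turn out to be equivalent
  -- to `φ`.
  let Γ : Set L.Form := {χ ∈ B | ∀ (W : Type u) (M : Model Θ W) (a : W),
    L.Sat M a φ → L.Sat M a χ}
  have hnot : ¬ L.Satisfiable Θ Γ {φ} := by
    rintro ⟨W₂, M₂, w₂, hΓ, hΔ⟩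
    -- A point satisfying `φ` whose `BIL`-theory is included in that of `w₂`.
    obtain ⟨W₁, M₁, w₁, hΓ₁, hΔ₁⟩ : L.Satisfiable Θ {φ} {χ ∈ B | ¬ L.Sat M₂ w₂ χ} := by
      refine hcomp Θ _ _ (Set.singleton_subset_iff.2 hφ) (fun χ hχ => hχ.1.1)
        fun Γ' Δ' hΓ' _ hΔ' hfin => ?_
      by_contra hunsat
      -- If `φ` cannot hold with all of `Δ'` false, the disjunction of `Δ'` is a consequence of `φ`,
      -- hence holds at `w₂`, although every member of `Δ'` fails there.
      obtain ⟨ψ, hψ, hψ'⟩ := exists_finite_disj L BIL hfin fun χ hχ => (hΔ' hχ).1.2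
      obtain ⟨χ, hχ, hχ'⟩ := hB ψ hψ
      have hχΓ : χ ∈ Γ := by
        refine ⟨hχ, fun W M a ha => ?_⟩
        rw [hχ', ← hψ']
        by_contra hno
        push Not at hno
        refine hunsat ⟨W, M, a, fun χ hχ => ?_, fun χ hχ => ⟨(hΔ' hχ).1.1, hno χ hχ⟩⟩
        obtain rfl := hΓ' hχ
        exact ⟨hφ, ha⟩
      have hs := (hΓ hχΓ).2
      rw [hχ', ← hψ'] at hs
      obtain ⟨δ, hδ, hs⟩ := hs
      exact (hΔ' hδ).2 hs
    refine (hΔ rfl).2 (h W₁ W₂ M₁ w₁ M₂ w₂ (fun ψ hψ hs => ?_) (hΓ₁ rfl).2)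
    obtain ⟨χ, hχ, hχ'⟩ := hB ψ hψ
    rw [← hχ'] at hs ⊢
    by_contra hs'
    exact (hΔ₁ ⟨hχ, hs'⟩).2 hs
  obtain ⟨Γ', Δ', hΓ', hfin, hΔ', hunsat⟩ : ∃ Γ' Δ' : Set L.Form, Γ' ⊆ Γ ∧ Γ'.Finite ∧
      Δ' ⊆ {φ} ∧ ¬ L.Satisfiable Θ Γ' Δ' := by
    by_contra hno
    push Not at hno
    exact hnot (hcomp Θ Γ {φ} (fun χ hχ => hχ.1.1) (Set.singleton_subset_iff.2 hφ)
      fun Γ' Δ' h1 h2 h3 _ => hno Γ' Δ' h1 h2 h3)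
  obtain ⟨ψ, hψ, hψ'⟩ := exists_finite_conj L BIL hfin fun χ hχ => (hΓ' hχ).1.2
  refine ⟨ψ, hψ, fun W M a => ⟨fun ha => (hψ' W M a).1 fun χ hχ => (hΓ' hχ).2 W M a ha,
    fun ha => ?_⟩⟩
  by_contra hno
  refine hunsat ⟨W, M, a, fun χ hχ => ⟨(hΓ' hχ).1.1, (hψ' W M a).2 ha χ hχ⟩, fun χ hχ => ?_⟩
  obtain rfl := hΔ' hχ
  exact ⟨hφ, hno⟩

end BiInt

theorem mainTheorem1 (L : BiInt.AbstractLogic.{u, v})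
    (hext : BiInt.BIL.{u}.ExtendedBy L)
    (hpres : L.PreservedUnderBiasimulations)
    (hcomp : L.StarCompact)
    (htup : L.TarskiUnionProperty) :
    BiInt.BIL.{u}.ExprEquiv L :=
  ⟨hext, fun _ _ hφ => BiInt.exists_BIL_equiv hext hcomp hφ fun _ _ M₁ w₁ M₂ w₂ h hw =>
    BiInt.sat_of_forall_BIL hext hpres hcomp htup M₁ w₁ M₂ w₂ h hφ hw⟩
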